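/- Consider a downlink with an $N$-antenna base station, $M$ clusters (cluster $m$ has $K_m$ users), unit-norm beamformers $\mathbf w_1,\dots,\mathbf w_M\in\mathbb C^N$, power allocation ratios $\theta_{m,k}\ge 0$, $P_m=\sum_{k=1}^{K_m}\theta_{m,k}$, and $J$ eavesdroppers. Eavesdropper $j$ has random fading vector $\mathbf g_{e,j}\sim\mathcal{CN}(\mathbf 0,\mu_{e,j}^2\mathbf I_N)$, and $\gamma_{e,j}=P\mu_{e,j}^2d_{e,j}^{-\alpha}/\sigma_e^2$ with $P,\mu_{e,j},d_{e,j},\sigma_e>0$ and $\alpha\in\mathbb R$. Its SINR for user $k$ of cluster $m$ is $$q^j_{m,k}=\frac{\left|\frac{\mathbf g_{e,j}^H\mathbf w_m}{\mu_{e,j}}\right|^2\theta_{m,k}}{\left|\frac{\mathbf g_{e,j}^H\mathbf w_m}{\mu_{e,j}}\right|^2\sum_{i\ne k}\theta_{m,i}+P_m\sum_{v\ne m}\left|\frac{\mathbf g_{e,j}^H\mathbf w_v}{\mu_{e,j}}\right|^2+\frac1{\gamma_{e,j}}}.$$ For a redundancy rate $D^j_{m,k}\in\mathbb R$ the secrecy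 outage probability is $p_{so}^{m,k,j}=\Pr\{D^j_{m,k}<\log_2(1+q^j_{m,k})\}$, and its closed form is $$c_{so}^{m,k,j}=\sum_{i:\lambda_i>0}\ \prod_{v\ne i}\left(1-\frac{\lambda_v}{\lambda_i}\right)^{-1}\exp\left(-\frac{2^{D^j_{m,k}}-1}{\lambda_i}\right),$$ where $\lambda_1,\dots,\lambda_N$ are the eigenvalues, with multiplicity, of $$\mathbf\Lambda=\gamma_{e,j}\Big(\theta_{m,k}-(2^{D^j_{m,k}}-1)\sum_{i\ne k}\theta_{m,i}\Big)\mathbf w_m\mathbf w_m^H-\gamma_{e,j}P_m(2^{D^j_{m,k}}-1)\sum_{v\ne m}\mathbf w_v\mathbf w_v^H .$$ For tunable parameters $\varepsilon_k\in(0,1]$ (which may also depend on $m$) let $$\kappa_{m,k,j}=\frac{\frac1{\gamma_{e,j}}+P_m\mathrm{Tr}\big(\sum_{v\ne m}\mathbf w_v\mathbf w_v^H\big)-P_m\sqrt{2\ln(\varepsilon_k^{-1})}\,\big\|\sum_{v\ne m}\mathbf w_v\mathbf w_v^H\big\|_F}{\big(1+\ln(\varepsilon_k^{-1})+\sqrt{2\ln(\varepsilon_k^{-1})}\big)\mathrm{Tr}(\mathbf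 w_m\mathbf w_m^H)} .$$ Consider the deterministic constraint $$2^{D^j_{m,k}}-1\ \ge\ \frac{\theta_{m,k}}{\kappa_{m,k,j}+\sum_{i\ne k}\theta_{m,i}}\ \ge\ 0,\qquad(\ast)$$ in which the denominator is required to be nonzero. Then, for all $m,k,j$ and every $\varepsilon_k\in(0,1]$, $(\ast)$ implies $p_{so}^{m,k,j}\le\varepsilon_k$ and $c_{so}^{m,k,j}\le\varepsilon_k$. Consequently, for every tolerance $\varepsilon\in(0,1)$, if all $\varepsilon_k\le\varepsilon$ (in particular if $\varepsilon_k=\varepsilon$), then $(\ast)$ for all $m,k,j$ implies the secrecy outage constraint $p_{so}^{m,k,j}\le\varepsilon$ and its closed form $c_{so}^{m,k,j}\le\varepsilon$ for all $m,k,j$; that is, $(\ast)$ is a tighter constraint. -/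

import Mathlib

open MeasureTheory ProbabilityTheory Matrix
open scoped ENNReal NNReal

attribute [local instance] Matrix.frobeniusNormedAddCommGroup

noncomputable section

/-- The circularly symmetric complex normal law `CN(0, v)`: independent real and imaginary parts,
each `N(0, v / 2)`. -/
def complexGaussian (v : ℝ≥0) : Measure ℂ :=
  ((gaussianReal 0 (v / 2)).prod (gaussianReal 0 (v / 2))).map (fun p => (⟨p.1, p.2⟩ : ℂ))

/-- The law `CN(0, v I_N)` on `ℂ^N`: i.i.d. `CN(0, v)` coordinates. -/
def complexGaussianVec (N : ℕ) (v : ℝ≥0) : Measure (Fin N → ℂ) :=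
  Measure.pi (fun _ => complexGaussian v)

/-- The deterministic parameters of the downlink: an `N`-antenna base station, `M` clusters with
`K m` users each, `J` eavesdroppers, unit-norm beamformers `w m`, total power `P`, path-loss
exponent `α`, eavesdropper noise variance `σ ^ 2`, and, for eavesdropper `j`, the fading standard
deviation `μ j` and the distance `d j`. -/
structure SecureNOMA where
  N : ℕ
  M : ℕ
  J : ℕ
  K : Fin M → ℕ
  w : Fin M → Fin N → ℂ
  w_unit : ∀ m, ∑ i, ‖w m i‖ ^ 2 = 1
  P : ℝ
  P_pos : 0 < P
  α : ℝ
  σ : ℝ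
  σ_pos : 0 < σ
  μ : Fin J → ℝ
  μ_pos : ∀ j, 0 < μ j
  d : Fin J → ℝ
  d_pos : ∀ j, 0 < d j

namespace SecureNOMA

variable (S : SecureNOMA)

/-- Power allocation ratios `θ_{m,k}`. -/
abbrev Alloc : Type := (m : Fin S.M) → Fin (S.K m) → ℝ

/-- `γ_{e,j} = P μ_{e,j}² d_{e,j}^{-α} / σ_e²`. -/
def γ (j : Fin S.J) : ℝ := S.P * S.μ j ^ 2 * S.d j ^ (-S.α) / S.σ ^ 2

/-- `W_m = w_m w_mᴴ`. -/
def W (m : Fin S.M) : Matrix (Fin S.N) (Fin S.N) ℂ := vecMulVec (S.w m) (star (S.w m))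

/-- `∑_{v ≠ m} w_v w_vᴴ`. -/
def Wperp (m : Fin S.M) : Matrix (Fin S.N) (Fin S.N) ℂ := ∑ v ∈ Finset.univ.erase m, S.W v

/-- `P_m = ∑_k θ_{m,k}`. -/
def clusterPower (θ : S.Alloc) (m : Fin S.M) : ℝ := ∑ k, θ m k

/-- `∑_{i ≠ k} θ_{m,i}`. -/
def othersPower (θ : S.Alloc) (m : Fin S.M) (k : Fin (S.K m)) : ℝ :=
  ∑ i ∈ Finset.univ.erase k, θ m i

/-- `|(gᴴ / μ_{e,j}) w_v|²`. -/
def gain (j : Fin S.J) (g : Fin S.N → ℂ) (v : Fin S.M) : ℝ :=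
  ‖(star g ⬝ᵥ S.w v) / (S.μ j : ℂ)‖ ^ 2

/-- The SINR `q^j_{m,k}` of eavesdropper `j` for user `k` of cluster `m`, when its small-scale
fading vector is `g`. -/
def eveSINR (θ : S.Alloc) (m : Fin S.M) (k : Fin (S.K m)) (j : Fin S.J) (g : Fin S.N → ℂ) : ℝ :=
  S.gain j g m * θ m k /
    (S.gain j g m * S.othersPower θ m k
      + S.clusterPower θ m * ∑ v ∈ Finset.univ.erase m, S.gain j g v + 1 / S.γ j)

/-- The secrecy outage probability `Pr {D < log₂ (1 + q^j_{m,k})}`, for the random fading vector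
`g` and the redundancy rate `D`. -/
def sop {Ω : Type*} [MeasurableSpace Ω] (Pr : Measure Ω) (g : Ω → Fin S.N → ℂ) (θ : S.Alloc)
    (m : Fin S.M) (k : Fin (S.K m)) (j : Fin S.J) (D : ℝ) : ℝ :=
  Pr.real {ω | D < Real.logb 2 (1 + S.eveSINR θ m k j (g ω))}

/-- The matrix `Λ` of the quadratic form that describes the secrecy outage event. -/
def Lam (θ : S.Alloc) (m : Fin S.M) (k : Fin (S.K m)) (j : Fin S.J) (D : ℝ) :
    Matrix (Fin S.N) (Fin S.N) ℂ :=
  (S.γ j * θ m k) • S.W m - (S.γ j * ((2 : ℝ) ^ D - 1) * S.othersPower θ m k) • S.W m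
    - (S.γ j * S.clusterPower θ m * ((2 : ℝ) ^ D - 1)) • S.Wperp m

theorem isHermitian_W (m : Fin S.M) : (S.W m).IsHermitian := by
  ext i j
  simp [W, vecMulVec_apply, mul_comm]

theorem isHermitian_Wperp (m : Fin S.M) : (S.Wperp m).IsHermitian := by
  unfold IsHermitian Wperp
  rw [conjTranspose_sum]
  exact Finset.sum_congr rfl fun v _ => S.isHermitian_W v

theorem isHermitian_Lam (θ : S.Alloc) (m : Fin S.M) (k : Fin (S.K m)) (j : Fin S.J) (D : ℝ) :
    (S.Lam θ m k j D).IsHermitian := by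
  have h1 := (S.isHermitian_W m).eq
  have h2 := (S.isHermitian_Wperp m).eq
  unfold IsHermitian Lam
  simp only [conjTranspose_sub, conjTranspose_smul, h1, h2, star_trivial]

/-- The closed form
`∑_i ∏_{v ≠ i} (1 - λ_v / λ_i)⁻¹ exp (-(2 ^ D - 1) / λ_i)` of the secrecy outage probability;
`λ` runs through the `N` eigenvalues of `Λ` (with multiplicity) and `i` through the positive ones.
For `D ≥ 0` and `θ ≥ 0` the matrix `Λ` is a rank-one matrix minus a positive semidefinite one, so
it has at most one positive eigenvalue, which is then simple, and no factor degenerates. -/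
def sopClosedForm (θ : S.Alloc) (m : Fin S.M) (k : Fin (S.K m)) (j : Fin S.J) (D : ℝ) : ℝ :=
  let ev : Fin S.N → ℝ := (S.isHermitian_Lam θ m k j D).eigenvalues
  ∑ i ∈ Finset.univ.filter (fun i => 0 < ev i),
    (∏ v ∈ Finset.univ.erase i, (1 - ev v / ev i)⁻¹) * Real.exp (-((2 : ℝ) ^ D - 1) / ev i)

/-- `κ_{m,k,j}` for the tunable parameter `e = ε_k`; `‖·‖` is the Frobenius norm, and the traces
are those of Hermitian matrices, hence real. -/
def kappa (θ : S.Alloc) (m : Fin S.M) (j : Fin S.J) (e : ℝ) : ℝ :=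
  (1 / S.γ j + S.clusterPower θ m * (S.Wperp m).trace.re
      - S.clusterPower θ m * √(2 * Real.log e⁻¹) * ‖S.Wperp m‖) /
    ((1 + Real.log e⁻¹ + √(2 * Real.log e⁻¹)) * (S.W m).trace.re)

/-- The deterministic constraint
`2 ^ D - 1 ≥ θ_{m,k} / (κ_{m,k,j} + ∑_{i ≠ k} θ_{m,i}) ≥ 0`, including that the quotient makes
sense. -/
def DetConstraint (θ : S.Alloc) (m : Fin S.M) (k : Fin (S.K m)) (j : Fin S.J) (e D : ℝ) : Prop :=
  S.kappa θ m j e + S.othersPower θ m k ≠ 0 ∧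
  (2 : ℝ) ^ D - 1 ≥ θ m k / (S.kappa θ m j e + S.othersPower θ m k) ∧
  θ m k / (S.kappa θ m j e + S.othersPower θ m k) ≥ 0

end SecureNOMA

end

/-!
Write `x = 2 ^ D - 1`, `b = θ_{m,k} - x ∑_{i ≠ k} θ_{m,i}` and `δ = log e⁻¹`. Clearing the denominator
of the SINR, outage means `x < gᴴ Λ g / μ²`. In an orthonormal eigenbasis of `Λ` the right-hand side
is `∑ λ_i |y_i|²` with `y ~ CN(0, I)`, because a circular Gaussian vector is unitarily invariant, and
Chernoff's bound gives, for every `t ≥ 0` with all `t λ_i < 1`, the bound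
`B t = exp (-t x) ∏ (1 - t λ_i)⁻¹` on the outage probability (`prob_quadForm_gt_le`).

The closed form obeys the same bound. On the orthogonal complement of `w_m` the form `Λ` is
nonpositive, so `Λ` has at most one positive eigenvalue `λ_i` (`eigenvalues_pos_unique`), the sum has
at most one term, and that term is at most `B t` factor by factor since `t < 1 / λ_i`
(`sum_prod_inv_mul_exp_le`).

It remains to find `t` with `B t ≤ exp (-δ) = e`. This is the sub-gamma (Bernstein) estimate: such a
`t` exists as soon as `tr Λ + √(2δ) ‖Λ‖_F + δ c ≤ x` for some `c > 0` above all eigenvalues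
(`exists_exp_mul_prod_le`). If `b > 0`, then `c = γ b` will do, and
`tr Λ + √(2δ) ‖Λ‖_F + δ γ b ≤ γ (b (1 + δ + √(2δ)) - x P_m (tr W⊥ - √(2δ) ‖W⊥‖_F))`, where
`b ≤ x κ` by the deterministic constraint; `κ` is defined so that the right-hand side is then at most
`x` (`trace_add_norm_add_le`). If `Λ` has no positive eigenvalue, which includes `b ≤ 0`, both
quantities vanish.
-/

/-! ### The sub-gamma Chernoff estimate -/

/-- The cumulant generating function of a standard exponential variable is sub-gamma. -/
theorem neg_log_one_sub_le {u a : ℝ} (hua : u ≤ a) (ha0 : 0 ≤ a) (ha : a < 1) :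
    -Real.log (1 - u) ≤ u + u ^ 2 / (2 * (1 - a)) := by
  have h1 : 0 < 1 - a := by linarith
  have key : -Real.log (1 - u) ≤ u + u ^ 2 / (2 * (1 - max u 0)) := by
    rcases le_total u 0 with hu | hu
    · rw [max_eq_right hu]
      have h := Real.le_log_one_add_of_nonneg (neg_nonneg.2 hu)
      have h2 : -u - u ^ 2 / 2 ≤ 2 * -u / (-u + 2) := by
        rw [le_div_iff₀ (by linarith)]
        nlinarith [mul_nonneg (neg_nonneg.2 hu) (sq_nonneg u)]
      rw [← sub_eq_add_neg] at h
      linarith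
    · rw [max_eq_left hu]
      have hu1 : 0 < 1 - u := by linarith
      -- With `a = -log (1 - u) ≥ 0` the claim reads `a ≤ sinh a`.
      have h : -Real.log (1 - u) ≤ Real.sinh (-Real.log (1 - u)) :=
        Real.self_le_sinh_iff.2 (neg_nonneg.2 (Real.log_nonpos hu1.le (by linarith)))
      rw [Real.sinh_eq, neg_neg, Real.exp_neg, Real.exp_log hu1] at h
      refine h.trans (le_of_eq ?_)
      field_simp
      ring
  refine key.trans ?_
  have : max u 0 ≤ a := max_le hua ha0
  gcongr

/-- The Chernoff bound for `∑ l i * E i > x` with `E i` independent standard exponentials, whose moment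
generating function is `∏ (1 - t * l i)⁻¹`, at the minimizer of its sub-gamma upper bound. Some `l i`
must be nonzero: otherwise only the limit `t → 1 / c` reaches `exp (-δ)`. -/
theorem exists_exp_mul_prod_le {ι : Type*} [Fintype ι] (l : ι → ℝ) {c δ x : ℝ} (hc : 0 < c)
    (hl : ∀ i, l i ≤ c) (hne : ∃ i, l i ≠ 0) (hδ : 0 ≤ δ)
    (hx : ∑ i, l i + √(2 * δ) * √(∑ i, l i ^ 2) + δ * c ≤ x) :
    ∃ t, 0 ≤ t ∧ t * c < 1 ∧ Real.exp (-(t * x)) * ∏ i, (1 - t * l i)⁻¹ ≤ Real.exp (-δ) := by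
  have hV : 0 < ∑ i, l i ^ 2 := by
    obtain ⟨i, hi⟩ := hne
    exact Finset.sum_pos' (fun i _ => sq_nonneg _) ⟨i, Finset.mem_univ _, by positivity⟩
  set s := √(2 * δ) with hs
  set r := √(∑ i, l i ^ 2) with hr
  have hr0 : 0 < r := Real.sqrt_pos.2 hV
  have hs0 : 0 ≤ s := Real.sqrt_nonneg _
  have hr2 : ∑ i, l i ^ 2 = r ^ 2 := (Real.sq_sqrt hV.le).symm
  have hs2 : δ = s ^ 2 / 2 := by rw [hs, Real.sq_sqrt (by positivity)]; ring
  have hd : 0 < r + c * s := by positivity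
  -- This `t` minimizes `-t * (s * r + δ * c) + t ^ 2 * r ^ 2 / (2 * (1 - t * c))`; the minimum is
  -- `-δ`.
  set t := s / (r + c * s) with ht
  have ht0 : 0 ≤ t := by positivity
  have htc' : 1 - t * c = r / (r + c * s) := by rw [ht]; field_simp; ring
  have htc : t * c < 1 := by
    have : 0 < r / (r + c * s) := by positivity
    linarith
  have hpos : ∀ i, 0 < 1 - t * l i := fun i => by
    have := mul_le_mul_of_nonneg_left (hl i) ht0
    linarith
  refine ⟨t, ht0, htc, ?_⟩
  have hprod : ∏ i, (1 - t * l i)⁻¹ = Real.exp (∑ i, -Real.log (1 - t * l i)) := by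
    rw [Real.exp_sum]
    exact Finset.prod_congr rfl fun i _ => by rw [Real.exp_neg, Real.exp_log (hpos i)]
  rw [hprod, ← Real.exp_add, Real.exp_le_exp]
  have hsum : ∑ i, -Real.log (1 - t * l i) ≤
      t * ∑ i, l i + t ^ 2 / (2 * (1 - t * c)) * r ^ 2 := by
    rw [← hr2, Finset.mul_sum, Finset.mul_sum, ← Finset.sum_add_distrib]
    refine Finset.sum_le_sum fun i _ => ?_
    refine (neg_log_one_sub_le (mul_le_mul_of_nonneg_left (hl i) ht0) (by positivity) htc).trans
      (le_of_eq ?_)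
    ring
  have hx' := mul_le_mul_of_nonneg_left hx ht0
  have key : t ^ 2 / (2 * (1 - t * c)) * r ^ 2 = t * (s * r + δ * c) - δ := by
    rw [htc', ht, hs2]; field_simp; ring
  linarith

/-! ### Circularly symmetric Gaussian vectors -/

theorem measurable_complex_mk : Measurable (fun p : ℝ × ℝ => (⟨p.1, p.2⟩ : ℂ)) :=
  Complex.measurableEquivRealProd.symm.measurable

instance (v : ℝ≥0) : IsProbabilityMeasure (complexGaussian v) :=
  Measure.isProbabilityMeasure_map measurable_complex_mk.aemeasurable

theorem charFun_complexGaussian (v : ℝ≥0) (z : ℂ) :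
    charFun (complexGaussian v) z = Complex.exp (-(v * ‖z‖ ^ 2 / 4 : ℝ)) := by
  have h : ∀ p : ℝ × ℝ, Complex.exp (inner ℝ (⟨p.1, p.2⟩ : ℂ) z * Complex.I) =
      Complex.exp (z.re * p.1 * Complex.I) * Complex.exp (z.im * p.2 * Complex.I) := fun p => by
    rw [← Complex.exp_add, Complex.inner]
    simp
    ring_nf
  rw [charFun_apply, complexGaussian, integral_map measurable_complex_mk.aemeasurable (by fun_prop)]
  simp_rw [h]
  rw [integral_prod_mul (fun x : ℝ => Complex.exp (z.re * x * Complex.I))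
      (fun x : ℝ => Complex.exp (z.im * x * Complex.I)),
    ← charFun_apply_real, ← charFun_apply_real, charFun_gaussianReal,
    charFun_gaussianReal, ← Complex.exp_add, Complex.sq_norm, Complex.normSq_apply]
  push_cast
  ring_nf

/-- Up to the constant factor, the integrand times the Gaussian density is again a Gaussian density,
of variance `(v / 2) / (1 - c * v)`. -/
theorem lintegral_exp_sq_gaussianReal {v : ℝ≥0} {c : ℝ} (hc : c * v < 1) :
    ∫⁻ x, ENNReal.ofReal (Real.exp (c * x ^ 2)) ∂(gaussianReal 0 (v / 2)) =
      ENNReal.ofReal (√(1 - c * v)⁻¹) := by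
  rcases eq_or_ne v 0 with rfl | hv
  · simp
  have hv0 : (0 : ℝ) < v := by positivity
  have hc' : 0 < 1 - c * v := by linarith
  set w : ℝ≥0 := v / 2 / ⟨1 - c * v, hc'.le⟩ with hw
  have hw0 : w ≠ 0 := by
    have : (⟨1 - c * v, hc'.le⟩ : ℝ≥0) ≠ 0 := fun h => hc'.ne' (congrArg NNReal.toReal h)
    exact div_ne_zero (by positivity) this
  have hwr : (w : ℝ) = v / 2 / (1 - c * v) := by rw [hw]; rfl
  rw [gaussianReal_of_var_ne_zero _ (by positivity), lintegral_withDensity_eq_lintegral_mul _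
    (measurable_gaussianPDF _ _) (by fun_prop)]
  have h : ∀ x : ℝ, (gaussianPDF 0 (v / 2) * fun x => ENNReal.ofReal (Real.exp (c * x ^ 2))) x =
      ENNReal.ofReal (√(1 - c * v)⁻¹) * gaussianPDF 0 w x := fun x => by
    rw [Pi.mul_apply, gaussianPDF, gaussianPDF, ← ENNReal.ofReal_mul (gaussianPDFReal_nonneg _ _ _),
      ← ENNReal.ofReal_mul (Real.sqrt_nonneg _)]
    congr 1
    rw [gaussianPDFReal, gaussianPDFReal, mul_assoc, ← Real.exp_add, ← mul_assoc, hwr,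
      ← Real.sqrt_inv, ← Real.sqrt_inv, ← Real.sqrt_mul (by positivity)]
    congr 2
    · push_cast; field_simp; rw [div_self]; linarith
    · push_cast; field_simp; ring
  simp_rw [h]
  rw [lintegral_const_mul _ (measurable_gaussianPDF _ _), lintegral_gaussianPDF_eq_one _ hw0,
    mul_one]

/-- For `z ~ CN(0, v)` the variable `‖z‖ ^ 2` is exponential with mean `v`. -/
theorem lintegral_exp_complexGaussian {v : ℝ≥0} {c : ℝ} (hc : c * v < 1) :
    ∫⁻ z, ENNReal.ofReal (Real.exp (c * ‖z‖ ^ 2)) ∂(complexGaussian v) =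
      ENNReal.ofReal (1 - c * v)⁻¹ := by
  have h : ∀ p : ℝ × ℝ, ENNReal.ofReal (Real.exp (c * ‖(⟨p.1, p.2⟩ : ℂ)‖ ^ 2)) =
      ENNReal.ofReal (Real.exp (c * p.1 ^ 2)) * ENNReal.ofReal (Real.exp (c * p.2 ^ 2)) :=
    fun p => by
      rw [← ENNReal.ofReal_mul (Real.exp_pos _).le, ← Real.exp_add, Complex.sq_norm,
        Complex.normSq_mk]
      ring_nf
  have hc' : 0 ≤ (1 - c * v)⁻¹ := inv_nonneg.2 (by linarith)
  rw [complexGaussian, lintegral_map (by fun_prop) measurable_complex_mk]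
  simp_rw [h]
  rw [lintegral_prod_mul (f := fun x : ℝ => ENNReal.ofReal (Real.exp (c * x ^ 2)))
    (g := fun x : ℝ => ENNReal.ofReal (Real.exp (c * x ^ 2))) (by fun_prop) (by fun_prop),
    lintegral_exp_sq_gaussianReal hc, ← ENNReal.ofReal_mul (Real.sqrt_nonneg _),
    Real.mul_self_sqrt hc']

instance (N : ℕ) (v : ℝ≥0) : IsProbabilityMeasure (complexGaussianVec N v) := by
  unfold complexGaussianVec; infer_instance

theorem charFun_complexGaussianVec (N : ℕ) (v : ℝ≥0) (z : EuclideanSpace ℂ (Fin N)) :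
    charFun ((complexGaussianVec N v).map (WithLp.toLp 2)) z =
      Complex.exp (-(v * ‖z‖ ^ 2 / 4 : ℝ)) := by
  unfold complexGaussianVec
  rw [charFun_pi]
  simp_rw [charFun_complexGaussian, ← Complex.exp_sum, EuclideanSpace.norm_sq_eq]
  simp [Finset.mul_sum, Finset.sum_div]

/-- Unitary invariance: the characteristic function depends on the norm of its argument only. -/
theorem complexGaussianVec_map_linearIsometryEquiv (N : ℕ) (v : ℝ≥0)
    (f : EuclideanSpace ℂ (Fin N) ≃ₗᵢ[ℂ] EuclideanSpace ℂ (Fin N)) :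
    ((complexGaussianVec N v).map (WithLp.toLp 2)).map f =
      (complexGaussianVec N v).map (WithLp.toLp 2) := by
  have : IsProbabilityMeasure ((complexGaussianVec N v).map (WithLp.toLp 2)) :=
    Measure.isProbabilityMeasure_map (by fun_prop)
  apply Measure.ext_of_charFun
  ext z
  rw [charFun_complexGaussianVec]
  let f' : EuclideanSpace ℂ (Fin N) ≃ₗᵢ[ℝ] EuclideanSpace ℂ (Fin N) :=
    { f.toLinearEquiv.restrictScalars ℝ with norm_map' := f.norm_map }
  rw [charFun_apply, integral_map (by fun_prop) (by fun_prop)]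
  have h : ∀ y, inner ℝ (f y) z = inner ℝ y (f'.symm z) := fun y =>
    LinearIsometryEquiv.inner_map_eq_flip f' y z
  simp_rw [h, ← charFun_apply]
  rw [charFun_complexGaussianVec, LinearIsometryEquiv.norm_map]

theorem lintegral_exp_complexGaussianVec {N : ℕ} {v : ℝ≥0} {c : Fin N → ℝ} (hc : ∀ i, c i * v < 1) :
    ∫⁻ z, ENNReal.ofReal (Real.exp (∑ i, c i * ‖z i‖ ^ 2)) ∂(complexGaussianVec N v) =
      ENNReal.ofReal (∏ i, (1 - c i * v)⁻¹) := by
  have hind := iIndepFun_pi (μ := fun _ : Fin N => complexGaussian v)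
    (X := fun i z => ENNReal.ofReal (Real.exp (c i * ‖z‖ ^ 2))) (fun i => by fun_prop)
  have h := lintegral_prod_eq_prod_lintegral_of_indepFun Finset.univ _ hind (fun i => by fun_prop)
  simp_rw [Real.exp_sum, ENNReal.ofReal_prod_of_nonneg fun i _ => (Real.exp_pos _).le]
  rw [complexGaussianVec, h, ENNReal.ofReal_prod_of_nonneg
    fun i _ => inv_nonneg.2 (by linarith [hc i])]
  refine Finset.prod_congr rfl fun i _ => ?_
  rw [← lintegral_exp_complexGaussian (hc i)]
  exact (measurePreserving_eval (fun _ : Fin N => complexGaussian v) i).lintegral_comp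
    (f := fun z : ℂ => ENNReal.ofReal (Real.exp (c i * ‖z‖ ^ 2))) (by fun_prop)

/-! ### Quadratic forms of Hermitian matrices -/

theorem re_quadForm_eq_sum_eigenvalues {N : ℕ} {A : Matrix (Fin N) (Fin N) ℂ} (hA : A.IsHermitian)
    (z : Fin N → ℂ) : (star z ⬝ᵥ (A *ᵥ z)).re =
      ∑ i, hA.eigenvalues i * ‖hA.eigenvectorBasis.repr (WithLp.toLp 2 z) i‖ ^ 2 := by
  have hr : ∀ i, hA.eigenvectorBasis.repr (WithLp.toLp 2 z) i =
      (star (hA.eigenvectorUnitary : Matrix (Fin N) (Fin N) ℂ) *ᵥ z) i := fun i => by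
    rw [OrthonormalBasis.repr_apply_apply, EuclideanSpace.inner_eq_star_dotProduct, mulVec,
      dotProduct_comm]
    rfl
  simp_rw [hr]
  conv_lhs => rw [hA.spectral_theorem, Unitary.conjStarAlgAut_apply]
  have hv : star z ᵥ* (hA.eigenvectorUnitary : Matrix (Fin N) (Fin N) ℂ) =
      star (star (hA.eigenvectorUnitary : Matrix (Fin N) (Fin N) ℂ) *ᵥ z) := by
    rw [star_mulVec, star_eq_conjTranspose, conjTranspose_conjTranspose]
  rw [← mulVec_mulVec, ← mulVec_mulVec, dotProduct_mulVec, hv]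
  simp [dotProduct, mulVec_diagonal, Complex.sq_norm, Complex.normSq_apply]
  refine Finset.sum_congr rfl fun i _ => ?_
  ring

/-- The Frobenius norm is the `ℓ²` norm of the eigenvalues; both squares are the trace of `A * A`. -/
theorem sqrt_sum_eigenvalues_sq {N : ℕ} {A : Matrix (Fin N) (Fin N) ℂ} (hA : A.IsHermitian) :
    √(∑ i, hA.eigenvalues i ^ 2) = ‖A‖ := by
  have h1 : (A * A).trace = ((∑ i, ∑ j, ‖A i j‖ ^ 2 : ℝ) : ℂ) := by
    conv_lhs => enter [1, 1]; rw [← hA.eq]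
    rw [Finset.sum_comm]
    simp [trace, mul_apply, conjTranspose_apply, Complex.conj_mul']
  have h2 : (A * A).trace = ((∑ i, hA.eigenvalues i ^ 2 : ℝ) : ℂ) := by
    conv_lhs => rw [hA.spectral_theorem, ← map_mul, Unitary.conjStarAlgAut_apply, trace_mul_comm,
      ← mul_assoc]
    simp [trace_diagonal, pow_two]
  rw [frobenius_norm_def, Real.sqrt_eq_rpow]
  congr 1
  have := h2.symm.trans h1
  simpa using (Complex.ofReal_injective this)

/-- A Hermitian form that is nonpositive on the orthogonal complement of a vector `w` has at most one
positive eigenvalue, with multiplicity: two of them would span a plane on which the form is positive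
definite, and that plane meets the complement of `w`. -/
theorem eigenvalues_pos_unique {N : ℕ} {A : Matrix (Fin N) (Fin N) ℂ} (hA : A.IsHermitian)
    (w : Fin N → ℂ) (h : ∀ z, star z ⬝ᵥ w = 0 → (star z ⬝ᵥ (A *ᵥ z)).re ≤ 0) {i l : Fin N}
    (hi : 0 < hA.eigenvalues i) (hl : 0 < hA.eigenvalues l) : i = l := by
  by_contra hil
  set b := hA.eigenvectorBasis
  have hne : ∀ i, 0 < hA.eigenvalues i → star (b i : Fin N → ℂ) ⬝ᵥ w ≠ 0 := fun i hi h0 => by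
    have := h _ h0
    rw [hA.eigenvalues_eq] at hi
    exact absurd hi (not_lt.2 this)
  set p := star (b i : Fin N → ℂ) ⬝ᵥ w
  set q := star (b l : Fin N → ℂ) ⬝ᵥ w
  -- The coefficients are chosen so that the combination is orthogonal to `w`.
  set y : EuclideanSpace ℂ (Fin N) := star q • b i - star p • b l with hy
  have hyw : star (y : Fin N → ℂ) ⬝ᵥ w = 0 := by
    simp only [hy, WithLp.ofLp_sub, WithLp.ofLp_smul, star_sub, star_smul, star_star,
      sub_dotProduct, smul_dotProduct, smul_eq_mul]
    ring
  have hrepr : b.repr y = EuclideanSpace.single i (star q) - EuclideanSpace.single l (star p) := by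
    rw [hy, map_sub, map_smul, map_smul, b.repr_self, b.repr_self]
    ext a
    simp
  have hq := h _ hyw
  rw [re_quadForm_eq_sum_eigenvalues hA] at hq
  refine absurd hq (not_le.2 ?_)
  have hterm : ∀ a, 0 ≤ hA.eigenvalues a * ‖b.repr y a‖ ^ 2 := fun a => by
    rcases eq_or_ne a i with rfl | hai
    · positivity
    rcases eq_or_ne a l with rfl | hal
    · positivity
    · simp [hrepr, hai, hal]
  refine Finset.sum_pos' (fun a _ => hterm a) ⟨i, Finset.mem_univ _, ?_⟩
  have h1 : b.repr y i = star q := by simp [hrepr, hil]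
  change 0 < hA.eigenvalues i * ‖b.repr y i‖ ^ 2
  rw [h1, norm_star]
  have := norm_pos_iff.2 (hne l hl)
  positivity

/-! ### Tail of a Gaussian quadratic form -/

/-- Chernoff's bound for a quadratic form in a circularly symmetric Gaussian vector. -/
theorem prob_quadForm_gt_le {Ω : Type*} [MeasurableSpace Ω] {Pr : Measure Ω}
    [IsProbabilityMeasure Pr] {N : ℕ} {v : ℝ≥0} (hv : v ≠ 0) {X : Ω → Fin N → ℂ}
    (hX : HasLaw X (complexGaussianVec N v) Pr) {A : Matrix (Fin N) (Fin N) ℂ}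
    (hA : A.IsHermitian) {t : ℝ} (ht : 0 ≤ t) (htA : ∀ i, t * hA.eigenvalues i < 1) (x : ℝ) :
    Pr.real {ω | x < (star (X ω) ⬝ᵥ (A *ᵥ X ω)).re / v} ≤
      Real.exp (-(t * x)) * ∏ i, (1 - t * hA.eigenvalues i)⁻¹ := by
  have hv0 : (0 : ℝ) < v := by positivity
  set b := hA.eigenvectorBasis
  set F : (Fin N → ℂ) → ℝ≥0∞ := fun y =>
    ENNReal.ofReal (Real.exp (∑ i, t * hA.eigenvalues i / v * ‖y i‖ ^ 2)) with hF
  have hFm : Measurable F := by fun_prop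
  have hR : 0 ≤ ∏ i, (1 - t * hA.eigenvalues i)⁻¹ :=
    Finset.prod_nonneg fun i _ => inv_nonneg.2 (by linarith [htA i])
  have hint : ∫⁻ ω, F (b.repr (WithLp.toLp 2 (X ω))) ∂Pr =
      ENNReal.ofReal (∏ i, (1 - t * hA.eigenvalues i)⁻¹) := by
    calc ∫⁻ ω, F (b.repr (WithLp.toLp 2 (X ω))) ∂Pr
        = ∫⁻ z, F (b.repr (WithLp.toLp 2 z)) ∂(complexGaussianVec N v) :=
          hX.lintegral_comp (f := fun z => F (b.repr (WithLp.toLp 2 z))) (by fun_prop)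
      _ = ∫⁻ z : EuclideanSpace ℂ (Fin N), F z
            ∂(((complexGaussianVec N v).map (WithLp.toLp 2)).map b.repr) := by
          rw [lintegral_map (by fun_prop) (by fun_prop), lintegral_map (by fun_prop) (by fun_prop)]
      _ = ∫⁻ z, F z ∂(complexGaussianVec N v) := by
          rw [complexGaussianVec_map_linearIsometryEquiv, lintegral_map (by fun_prop) (by fun_prop)]
      _ = _ := by
          rw [hF, lintegral_exp_complexGaussianVec]
          · simp only [div_mul_cancel₀ _ hv0.ne']
          · intro i
            rw [div_mul_cancel₀ _ hv0.ne']
            exact htA i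
  have hle : Pr {ω | x < (star (X ω) ⬝ᵥ (A *ᵥ X ω)).re / v} ≤
      ENNReal.ofReal (Real.exp (-(t * x))) * ENNReal.ofReal (∏ i, (1 - t * hA.eigenvalues i)⁻¹) := by
    rw [← hint, ← lintegral_const_mul'' _ (by have := hX.aemeasurable; fun_prop),
      ← lintegral_indicator_one₀]
    · refine lintegral_mono fun ω => Set.indicator_apply_le' (fun hω => ?_) fun _ => zero_le
      rw [← ENNReal.ofReal_mul (Real.exp_pos _).le, ← Real.exp_add, Pi.one_apply,
        ENNReal.one_le_ofReal, Real.one_le_exp_iff]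
      have h1 : ∑ i, t * hA.eigenvalues i / v * ‖b.repr (WithLp.toLp 2 (X ω)) i‖ ^ 2 =
          t * ((star (X ω) ⬝ᵥ (A *ᵥ X ω)).re / v) := by
        rw [re_quadForm_eq_sum_eigenvalues hA, Finset.sum_div, Finset.mul_sum]
        exact Finset.sum_congr rfl fun i _ => by ring
      rw [h1]
      have h2 := mul_le_mul_of_nonneg_left (le_of_lt (Set.mem_ofPred.1 hω)) ht
      linarith
    · have hm : Measurable fun z : Fin N → ℂ => (star z ⬝ᵥ (A *ᵥ z)).re / v := by
        simp only [dotProduct, mulVec, Pi.star_apply, RCLike.star_def]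
        have : Measurable (starRingEnd ℂ) := Complex.continuous_conj.measurable
        fun_prop
      exact nullMeasurableSet_lt aemeasurable_const (hm.comp_aemeasurable hX.aemeasurable)
  rw [← ENNReal.ofReal_mul (Real.exp_pos _).le] at hle
  exact ENNReal.toReal_le_of_le_ofReal (by positivity) hle

/-! ### The closed form -/

/-- If `l` has exactly one positive entry, the closed form of the tail of `∑ l i * E i`, for independent
standard exponentials `E i`, is at most Chernoff's bound for every admissible `t`. -/
theorem sum_prod_inv_mul_exp_le {ι : Type*} [Fintype ι] [DecidableEq ι] {l : ι → ℝ} {i : ι}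
    (hi : 0 < l i) (huniq : ∀ a, 0 < l a → a = i) {x t : ℝ} (hx : 0 ≤ x) (ht : 0 ≤ t)
    (hti : t * l i < 1) :
    ∑ a ∈ Finset.univ.filter (fun a => 0 < l a),
      (∏ v ∈ Finset.univ.erase a, (1 - l v / l a)⁻¹) * Real.exp (-x / l a) ≤
    Real.exp (-(t * x)) * ∏ a, (1 - t * l a)⁻¹ := by
  have hfil : Finset.univ.filter (fun a => 0 < l a) = {i} := by
    ext a
    simp only [Finset.mem_filter, Finset.mem_univ, true_and, Finset.mem_singleton]
    exact ⟨huniq a, fun h => h ▸ hi⟩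
  have htl : t ≤ 1 / l i := ((lt_div_iff₀ hi).2 hti).le
  have hle : ∀ v ∈ Finset.univ.erase i, l v ≤ 0 := fun v hv =>
    not_lt.1 fun h => Finset.ne_of_mem_erase hv (huniq v h)
  have hdiv : ∀ v ∈ Finset.univ.erase i, l v / l i ≤ t * l v := fun v hv => by
    have := mul_le_mul_of_nonpos_right htl (hle v hv)
    rwa [one_div, inv_mul_eq_div] at this
  have hnonpos : ∀ v ∈ Finset.univ.erase i, t * l v ≤ 0 := fun v hv =>
    mul_nonpos_of_nonneg_of_nonpos ht (hle v hv)
  have hprod : ∏ v ∈ Finset.univ.erase i, (1 - l v / l i)⁻¹ ≤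
      ∏ v ∈ Finset.univ.erase i, (1 - t * l v)⁻¹ := by
    refine Finset.prod_le_prod (fun v hv => ?_) fun v hv => ?_
    · exact inv_nonneg.2 (by linarith [hdiv v hv, hnonpos v hv])
    · exact inv_anti₀ (by linarith [hnonpos v hv]) (by linarith [hdiv v hv])
  have hpos : 0 ≤ ∏ v ∈ Finset.univ.erase i, (1 - t * l v)⁻¹ :=
    Finset.prod_nonneg fun v hv => inv_nonneg.2 (by linarith [hnonpos v hv])
  have hone : 1 ≤ (1 - t * l i)⁻¹ :=
    (one_le_inv₀ (by linarith)).2 (by linarith [mul_nonneg ht hi.le])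
  have hexp : Real.exp (-x / l i) ≤ Real.exp (-(t * x)) := by
    rw [Real.exp_le_exp, neg_div, neg_le_neg_iff, div_eq_mul_one_div, mul_comm t]
    exact mul_le_mul_of_nonneg_left htl hx
  rw [hfil, Finset.sum_singleton, ← Finset.mul_prod_erase _ _ (Finset.mem_univ i)]
  calc (∏ v ∈ Finset.univ.erase i, (1 - l v / l i)⁻¹) * Real.exp (-x / l i)
      ≤ (∏ v ∈ Finset.univ.erase i, (1 - t * l v)⁻¹) * Real.exp (-(t * x)) := by gcongr
    _ ≤ (1 - t * l i)⁻¹ * ((∏ v ∈ Finset.univ.erase i, (1 - t * l v)⁻¹) * Real.exp (-(t * x))) :=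
        le_mul_of_one_le_left (by positivity) hone
    _ = _ := by ring

/-! ### The secrecy outage event -/

namespace SecureNOMA

variable (S : SecureNOMA)

theorem γ_pos (j : Fin S.J) : 0 < S.γ j := by
  have := S.P_pos; have := S.μ_pos j; have := Real.rpow_pos_of_pos (S.d_pos j) (-S.α)
  have := S.σ_pos
  unfold γ; positivity

theorem quadForm_W (v : Fin S.M) (g : Fin S.N → ℂ) :
    star g ⬝ᵥ (S.W v *ᵥ g) = ((‖star g ⬝ᵥ S.w v‖ ^ 2 : ℝ) : ℂ) := by
  have h : star (S.w v) ⬝ᵥ g = star (star g ⬝ᵥ S.w v) := by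
    rw [star_dotProduct]
  rw [W, vecMulVec_mulVec, dotProduct_smul, op_smul_eq_smul, smul_eq_mul, h, mul_comm]
  simp [Complex.mul_conj']

theorem quadForm_Lam (θ : S.Alloc) (m : Fin S.M) (k : Fin (S.K m)) (j : Fin S.J) (D : ℝ)
    (g : Fin S.N → ℂ) :
    (star g ⬝ᵥ (S.Lam θ m k j D *ᵥ g)).re =
      S.γ j * ((θ m k - ((2 : ℝ) ^ D - 1) * S.othersPower θ m k) * ‖star g ⬝ᵥ S.w m‖ ^ 2
        - ((2 : ℝ) ^ D - 1) * S.clusterPower θ m *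
          ∑ v ∈ Finset.univ.erase m, ‖star g ⬝ᵥ S.w v‖ ^ 2) := by
  simp only [Lam, Wperp, sub_mulVec, smul_mulVec, sum_mulVec, dotProduct_sub, dotProduct_smul,
    dotProduct_sum, quadForm_W, Complex.sub_re, Complex.smul_re, Complex.ofReal_re,
    ← Complex.ofReal_sum, smul_eq_mul]
  ring

/-- The outage event, with the denominator of the SINR cleared. -/
theorem quadForm_of_outage (θ : S.Alloc) (hθ : ∀ m k, 0 ≤ θ m k) (m : Fin S.M) (k : Fin (S.K m))
    (j : Fin S.J) {D : ℝ} (g : Fin S.N → ℂ)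
    (h : D < Real.logb 2 (1 + S.eveSINR θ m k j g)) :
    (2 : ℝ) ^ D - 1 < (star g ⬝ᵥ (S.Lam θ m k j D *ᵥ g)).re / S.μ j ^ 2 := by
  have hγ := S.γ_pos j
  have hs : 0 ≤ S.othersPower θ m k := Finset.sum_nonneg fun i _ => hθ m i
  have hp : 0 ≤ S.clusterPower θ m := Finset.sum_nonneg fun i _ => hθ m i
  have hgain : ∀ v, 0 ≤ S.gain j g v := fun v => sq_nonneg _
  have hB : 0 ≤ ∑ v ∈ Finset.univ.erase m, S.gain j g v := Finset.sum_nonneg fun v _ => hgain v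
  have hden : 0 < S.gain j g m * S.othersPower θ m k
      + S.clusterPower θ m * ∑ v ∈ Finset.univ.erase m, S.gain j g v + 1 / S.γ j := by
    have := mul_nonneg (hgain m) hs
    positivity
  have hq : 0 ≤ S.eveSINR θ m k j g :=
    div_nonneg (mul_nonneg (hgain m) (hθ m k)) hden.le
  rw [Real.lt_logb_iff_rpow_lt (by norm_num) (by linarith)] at h
  have h' : (2 : ℝ) ^ D - 1 < S.eveSINR θ m k j g := by linarith
  rw [eveSINR, lt_div_iff₀ hden] at h'
  have hnorm : ∀ v, ‖star g ⬝ᵥ S.w v‖ ^ 2 = S.μ j ^ 2 * S.gain j g v := fun v => by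
    have := (S.μ_pos j).ne'
    rw [gain, norm_div, Complex.norm_real, div_pow, Real.norm_eq_abs, sq_abs]
    field_simp
  have hμ : 0 < S.μ j ^ 2 := pow_pos (S.μ_pos j) 2
  rw [quadForm_Lam, lt_div_iff₀ hμ]
  simp_rw [hnorm, ← Finset.mul_sum]
  have h2 := mul_lt_mul_of_pos_left h' (mul_pos hγ hμ)
  have h3 : S.γ j * (1 / S.γ j) = 1 := mul_one_div_cancel hγ.ne'
  linear_combination h2 + (1 - (2 : ℝ) ^ D) * S.μ j ^ 2 * h3

theorem trace_W (m : Fin S.M) : (S.W m).trace = 1 := by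
  have := S.w_unit m
  rw [W, trace_vecMulVec]
  simp only [dotProduct, Pi.star_apply, RCLike.star_def, Complex.mul_conj']
  exact_mod_cast this

theorem norm_W (m : Fin S.M) : ‖S.W m‖ = 1 := by
  rw [frobenius_norm_def]
  simp [W, vecMulVec_apply, mul_pow, ← Finset.mul_sum, S.w_unit m]

theorem norm_Lam_le (θ : S.Alloc) (hθ : ∀ m k, 0 ≤ θ m k) (m : Fin S.M) (k : Fin (S.K m))
    (j : Fin S.J) {D : ℝ} (hx : 0 ≤ (2 : ℝ) ^ D - 1)
    (hb : 0 ≤ θ m k - ((2 : ℝ) ^ D - 1) * S.othersPower θ m k) :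
    ‖S.Lam θ m k j D‖ ≤ S.γ j * (θ m k - ((2 : ℝ) ^ D - 1) * S.othersPower θ m k
      + ((2 : ℝ) ^ D - 1) * S.clusterPower θ m * ‖S.Wperp m‖) := by
  let := Matrix.frobeniusNormedSpace (m := Fin S.N) (n := Fin S.N) (R := ℝ) (α := ℂ)
  have hγ := (S.γ_pos j).le
  have hp : 0 ≤ S.clusterPower θ m := Finset.sum_nonneg fun i _ => hθ m i
  rw [Lam, ← sub_smul]
  refine (norm_sub_le _ _).trans (le_of_eq ?_)
  rw [norm_smul, norm_smul, norm_W, mul_assoc (S.γ j), ← mul_sub,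
    Real.norm_of_nonneg (by positivity), Real.norm_of_nonneg (by positivity)]
  ring

theorem trace_Lam (θ : S.Alloc) (m : Fin S.M) (k : Fin (S.K m)) (j : Fin S.J) (D : ℝ) :
    (S.Lam θ m k j D).trace.re = S.γ j * (θ m k - ((2 : ℝ) ^ D - 1) * S.othersPower θ m k
      - ((2 : ℝ) ^ D - 1) * S.clusterPower θ m * (S.Wperp m).trace.re) := by
  simp only [Lam, trace_sub, trace_smul, trace_W, Complex.sub_re, Complex.smul_re, Complex.one_re,
    smul_eq_mul]
  ring

theorem norm_dotProduct_w_le (m : Fin S.M) (u : EuclideanSpace ℂ (Fin S.N)) (hu : ‖u‖ = 1) :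
    ‖star (u : Fin S.N → ℂ) ⬝ᵥ S.w m‖ ^ 2 ≤ 1 := by
  have hw : ‖WithLp.toLp 2 (S.w m)‖ = 1 := by
    rw [EuclideanSpace.norm_eq]
    simp [S.w_unit m]
  have h := norm_inner_le_norm (𝕜 := ℂ) u (WithLp.toLp 2 (S.w m))
  rw [hu, hw, EuclideanSpace.inner_eq_star_dotProduct, dotProduct_comm] at h
  nlinarith [norm_nonneg (star (u : Fin S.N → ℂ) ⬝ᵥ S.w m)]

/-- Only the rank-one part of `Λ` can contribute positively, and `w m` is a unit vector. -/
theorem eigenvalues_Lam_le (θ : S.Alloc) (hθ : ∀ m k, 0 ≤ θ m k) (m : Fin S.M) (k : Fin (S.K m))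
    (j : Fin S.J) {D : ℝ} (hx : 0 ≤ (2 : ℝ) ^ D - 1)
    (i : Fin S.N) : (S.isHermitian_Lam θ m k j D).eigenvalues i ≤
      S.γ j * max (θ m k - ((2 : ℝ) ^ D - 1) * S.othersPower θ m k) 0 := by
  have hp : 0 ≤ S.clusterPower θ m := Finset.sum_nonneg fun i _ => hθ m i
  have hA := S.isHermitian_Lam θ m k j D
  rw [hA.eigenvalues_eq, RCLike.re_eq_complex_re, quadForm_Lam]
  refine mul_le_mul_of_nonneg_left ?_ (S.γ_pos j).le
  set u := hA.eigenvectorBasis i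
  have h1 := S.norm_dotProduct_w_le m u (hA.eigenvectorBasis.orthonormal.1 i)
  have h2 : 0 ≤ ((2 : ℝ) ^ D - 1) * S.clusterPower θ m *
      ∑ v ∈ Finset.univ.erase m, ‖star (u : Fin S.N → ℂ) ⬝ᵥ S.w v‖ ^ 2 := by positivity
  refine (sub_le_self _ h2).trans ?_
  calc _ ≤ max (θ m k - ((2 : ℝ) ^ D - 1) * S.othersPower θ m k) 0 *
        ‖star (u : Fin S.N → ℂ) ⬝ᵥ S.w m‖ ^ 2 := by gcongr; exact le_max_left _ _
    _ ≤ _ := mul_le_of_le_one_right (le_max_right _ _) h1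

/-- The deterministic constraint yields the hypothesis of the sub-gamma estimate for the eigenvalues of
`Λ`; `κ` is the value of `b / x` for which the triangle-inequality bound for the left-hand side equals
`x`, where `b = θ_{m,k} - x ∑_{i ≠ k} θ_{m,i}`. -/
theorem trace_add_norm_add_le (θ : S.Alloc) (hθ : ∀ m k, 0 ≤ θ m k) (m : Fin S.M)
    (k : Fin (S.K m)) (j : Fin S.J) {e D : ℝ} (he : 0 < e) (he1 : e ≤ 1)
    (hdet : S.DetConstraint θ m k j e D)
    (hb : 0 < θ m k - ((2 : ℝ) ^ D - 1) * S.othersPower θ m k) :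
    (S.Lam θ m k j D).trace.re + √(2 * Real.log e⁻¹) * ‖S.Lam θ m k j D‖ +
      Real.log e⁻¹ * (S.γ j * (θ m k - ((2 : ℝ) ^ D - 1) * S.othersPower θ m k)) ≤
      (2 : ℝ) ^ D - 1 := by
  obtain ⟨hne, hle, hnn⟩ := hdet
  have hx : 0 ≤ (2 : ℝ) ^ D - 1 := hnn.trans hle
  have hs : 0 ≤ S.othersPower θ m k := Finset.sum_nonneg fun i _ => hθ m i
  have hθ0 : 0 < θ m k := by nlinarith [mul_nonneg hx hs]
  have hks : 0 < S.kappa θ m j e + S.othersPower θ m k := by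
    rcases lt_or_gt_of_ne hne with h | h
    · exact absurd hnn (not_le.2 (div_neg_of_pos_of_neg hθ0 h))
    · exact h
  have hγ := S.γ_pos j
  have hδ : 0 ≤ Real.log e⁻¹ := Real.log_nonneg ((one_le_inv₀ he).2 he1)
  have hnorm := S.norm_Lam_le θ hθ m k j hx hb.le
  rw [ge_iff_le, div_le_iff₀ hks] at hle
  set x := (2 : ℝ) ^ D - 1
  set δ := Real.log e⁻¹
  set r := √(2 * δ)
  have hr : 0 ≤ r := Real.sqrt_nonneg _
  have hden : 0 < 1 + δ + r := by positivity
  have hκ : S.kappa θ m j e * (1 + δ + r) = 1 / S.γ j + S.clusterPower θ m * (S.Wperp m).trace.re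
      - S.clusterPower θ m * r * ‖S.Wperp m‖ := by
    rw [kappa, trace_W, Complex.one_re, mul_one]
    exact div_mul_cancel₀ _ hden.ne'
  have hbκ : (θ m k - x * S.othersPower θ m k) * (1 + δ + r) ≤
      x * (S.kappa θ m j e * (1 + δ + r)) := by
    rw [← mul_assoc]
    exact mul_le_mul_of_nonneg_right (by linarith) hden.le
  rw [hκ] at hbκ
  have h1 := mul_le_mul_of_nonneg_left hbκ hγ.le
  have h2 := mul_le_mul_of_nonneg_left hnorm hr
  have h3 : S.γ j * (1 / S.γ j) = 1 := mul_one_div_cancel hγ.ne'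
  rw [trace_Lam]
  linear_combination h1 + h2 + x * h3

theorem sop_le_and_sopClosedForm_le {Ω : Type*} [MeasurableSpace Ω] (Pr : Measure Ω)
    [IsProbabilityMeasure Pr] {j : Fin S.J} {g : Ω → Fin S.N → ℂ}
    (hg : HasLaw g (complexGaussianVec S.N (Real.toNNReal (S.μ j ^ 2))) Pr)
    (θ : S.Alloc) (hθ : ∀ m k, 0 ≤ θ m k) (m : Fin S.M) (k : Fin (S.K m)) {e D : ℝ}
    (he : 0 < e) (he1 : e ≤ 1) (hdet : S.DetConstraint θ m k j e D) :
    S.sop Pr g θ m k j D ≤ e ∧ S.sopClosedForm θ m k j D ≤ e := by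
  have hx : 0 ≤ (2 : ℝ) ^ D - 1 := hdet.2.2.trans hdet.2.1
  have hμ : 0 < S.μ j ^ 2 := pow_pos (S.μ_pos j) 2
  have hγ := S.γ_pos j
  have hp : 0 ≤ S.clusterPower θ m := Finset.sum_nonneg fun i _ => hθ m i
  have hA := S.isHermitian_Lam θ m k j D
  have hsub : {ω | D < Real.logb 2 (1 + S.eveSINR θ m k j (g ω))} ⊆
      {ω | (2 : ℝ) ^ D - 1 < (star (g ω) ⬝ᵥ (S.Lam θ m k j D *ᵥ g ω)).re / S.μ j ^ 2} :=
    fun ω hω => S.quadForm_of_outage θ hθ m k j (g ω) hω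
  by_cases hpos : ∃ i, 0 < hA.eigenvalues i
  · obtain ⟨i, hi⟩ := hpos
    have hlam := S.eigenvalues_Lam_le θ hθ m k j hx
    -- A positive eigenvalue can only come from the rank-one part of `Λ`.
    have hb : 0 < θ m k - ((2 : ℝ) ^ D - 1) * S.othersPower θ m k := by
      by_contra! hb
      have := hlam i
      rw [max_eq_right hb, mul_zero] at this
      exact absurd hi (not_lt.2 this)
    rw [max_eq_left hb.le] at hlam
    have hδ : 0 ≤ Real.log e⁻¹ := Real.log_nonneg ((one_le_inv₀ he).2 he1)
    have hbern := S.trace_add_norm_add_le θ hθ m k j he he1 hdet hb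
    rw [← sqrt_sum_eigenvalues_sq hA, hA.trace_eq_sum_eigenvalues] at hbern
    simp only [Complex.coe_algebraMap, Complex.re_sum, Complex.ofReal_re] at hbern
    obtain ⟨t, ht, htc, hexp⟩ := exists_exp_mul_prod_le hA.eigenvalues (mul_pos hγ hb) hlam
      ⟨i, hi.ne'⟩ hδ hbern
    rw [Real.log_inv, neg_neg, Real.exp_log he] at hexp
    have htl : ∀ a, t * hA.eigenvalues a < 1 := fun a =>
      (mul_le_mul_of_nonneg_left (hlam a) ht).trans_lt htc
    constructor
    · refine (measureReal_mono hsub).trans (le_trans ?_ hexp)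
      have h := prob_quadForm_gt_le (Real.toNNReal_pos.2 hμ).ne' hg hA ht htl ((2 : ℝ) ^ D - 1)
      rwa [Real.coe_toNNReal _ hμ.le] at h
    · refine (sum_prod_inv_mul_exp_le hi (fun a ha => ?_) hx ht (htl i)).trans hexp
      refine eigenvalues_pos_unique hA (S.w m) (fun z hz => ?_) ha hi
      rw [quadForm_Lam, hz, norm_zero, zero_pow two_ne_zero, mul_zero, zero_sub]
      exact mul_nonpos_of_nonneg_of_nonpos hγ.le (neg_nonpos.2 (by positivity))
  -- Without positive eigenvalues the outage event and the sum are both empty.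
  · push Not at hpos
    constructor
    · refine (measureReal_mono hsub).trans ?_
      have : {ω | (2 : ℝ) ^ D - 1 < (star (g ω) ⬝ᵥ (S.Lam θ m k j D *ᵥ g ω)).re / S.μ j ^ 2} = ∅ := by
        refine Set.eq_empty_of_forall_notMem fun ω hω => absurd (Set.mem_ofPred.1 hω) (not_lt.2 ?_)
        refine le_trans (div_nonpos_of_nonpos_of_nonneg ?_ hμ.le) hx
        rw [re_quadForm_eq_sum_eigenvalues hA]
        exact Finset.sum_nonpos fun i _ =>
          mul_nonpos_of_nonpos_of_nonneg (hpos i) (sq_nonneg _)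
      rw [this, measureReal_empty]
      exact he.le
    · have hf : Finset.univ.filter (fun i => 0 < hA.eigenvalues i) = ∅ :=
        Finset.filter_eq_empty_iff.2 fun i _ => not_lt.2 (hpos i)
      simp only [sopClosedForm, hf, Finset.sum_empty]
      exact he.le

end SecureNOMA

theorem lemma1 (S : SecureNOMA)
    {Ω : Type*} [MeasurableSpace Ω] (Pr : Measure Ω) [IsProbabilityMeasure Pr]
    (g : Fin S.J → Ω → Fin S.N → ℂ)
    (hg : ∀ j, HasLaw (g j) (complexGaussianVec S.N (Real.toNNReal (S.μ j ^ 2))) Pr)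
    (θ : S.Alloc) (hθ : ∀ m k, 0 ≤ θ m k)
    (D : (m : Fin S.M) → Fin (S.K m) → Fin S.J → ℝ)
    (e : (m : Fin S.M) → Fin (S.K m) → ℝ) (he : ∀ m k, 0 < e m k ∧ e m k ≤ 1) :
    (∀ m k j, S.DetConstraint θ m k j (e m k) (D m k j) →
      S.sop Pr (g j) θ m k j (D m k j) ≤ e m k ∧
      S.sopClosedForm θ m k j (D m k j) ≤ e m k) ∧
    (∀ ε : ℝ, 0 < ε → ε < 1 → (∀ m k, e m k ≤ ε) →
      (∀ m k j, S.DetConstraint θ m k j (e m k) (D m k j)) →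
      ∀ m k j, S.sop Pr (g j) θ m k j (D m k j) ≤ ε ∧
        S.sopClosedForm θ m k j (D m k j) ≤ ε) := by
  have key : ∀ m k j, S.DetConstraint θ m k j (e m k) (D m k j) →
      S.sop Pr (g j) θ m k j (D m k j) ≤ e m k ∧ S.sopClosedForm θ m k j (D m k j) ≤ e m k :=
    fun m k j hdet =>
      S.sop_le_and_sopClosedForm_le Pr (hg j) θ hθ m k (he m k).1 (he m k).2 hdet
  exact ⟨key, fun ε _ _ hε hdet m k j =>
    ⟨(key m k j (hdet m k j)).1.trans (hε m k), (key m k j (hdet m k j)).2.trans (hε m k)⟩⟩
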